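/- Let $(\Omega,\mathcal F,(\mathcal F_t)_{t\ge 0},\mathbb P)$ be a filtered probability space satisfying the usual conditions, carrying a standard Brownian motion $B$ and a Poisson process $N$ with intensity $r>0$, both relative to $(\mathcal F_t)$ and independent of each other. Let $\tau>0$, $T>0$ and $c<0$. For $a\in\mathbb R$ and $S>0$, a solution on $[0,S]$ of the delay equation $$Z(t)=a+\int_0^t Z(s-\tau)\,dB(s)-\int_0^t Z(s-\tau)\,dN(s),\quad t\in[0,S];\qquad Z(\theta)=a,\quad \theta\in[-\tau,0), \tag{$E_a$}$$ is an adapted process on $[-\tau,S]$ with almost surely càdlàg paths such that, for every $t\in[0,S]$, the equation holds almost surely, and almost surely $Z(\theta)=a$ for all $\theta\in[-\tau,0)$. Here the first integral is the Itô integral and the second is the pathwise integral over $(0,t]$. (i) Let $X$ solve $(E_c)$ on $[0,T]$ and let $Y$ solve $(E_0)$ on $[0,T]$. Then, almost surely, $X(t)=c\,(1+B(t)-N(t))$ and $Y(t)=0$ for all $t\in[0,\tau\wedge T]$. For every $t\in(0,\tau\wedge T]$, $$\mathbb P\{X(t)>0\}\ \ge\ \mathbb P\{B(t)<-1\}\ >\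 0,$$ and the set $\{(t,\omega)\in[0,\tau\wedge T]\times\Omega: X(t,\omega)>0\}$ has positive $dt\otimes\mathbb P$ measure. Consequently the comparison fails: although almost surely $X(\theta)\le Y(\theta)$ for all $\theta\in[-\tau,0]$, it is not true that almost surely $X(t)\le Y(t)$ for all $t\in[0,T]$. (ii) The process equal to $c$ at negative times and to $c\,(1+B(t)-N(t))$ at times $t\ge 0$ is a solution of $(E_c)$ on $[0,\tau\wedge T]$, and the zero process is a solution of $(E_0)$ on $[0,\tau\wedge T]$; so the failure in (i) does occur, with $\tau\wedge T$ in place of $T$. -/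

import Mathlib

open MeasureTheory ProbabilityTheory Filter Set
open scoped NNReal ENNReal Topology

noncomputable section

namespace DelayJump

variable {Ω : Type*} {mΩ : MeasurableSpace Ω}

/-- The usual conditions: the filtration is right-continuous and its initial `σ`-algebra contains
all `P`-null sets. -/
structure UsualConditions (F : Filtration ℝ≥0 mΩ) (P : Measure Ω) : Prop where
  rightContinuous : F.IsRightContinuous
  null_mem : ∀ A : Set Ω, P A = 0 → MeasurableSet[F 0] A

/-- `B` is a Brownian motion relative to the filtration `F`: a standard Brownian motion, adapted
to `F`, whose increments after time `s` are independent of `F s`. -/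
structure IsBrownianWrt (F : Filtration ℝ≥0 mΩ) (P : Measure Ω) (B : ℝ≥0 → Ω → ℝ) : Prop where
  isBrownian : IsBrownianReal B P
  adapted : Adapted F B
  indep : ∀ s t : ℝ≥0, s ≤ t →
    Indep (MeasurableSpace.comap (fun ω => B t ω - B s ω) inferInstance) (F s) P

/-- `N` is a Poisson process with intensity `r` relative to the filtration `F`: it is adapted and
starts at `0`, almost all of its paths are nondecreasing and right-continuous, and for `s ≤ t` the
increment `N t - N s` has the Poisson law of mean `r * (t - s)` and is independent of `F s`.
(The subtraction is in `ℕ`; it does not truncate, as `N s ≤ N t` almost surely.) -/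
structure IsPoissonWrt (F : Filtration ℝ≥0 mΩ) (P : Measure Ω) (r : ℝ≥0)
    (N : ℝ≥0 → Ω → ℕ) : Prop where
  adapted : Adapted F N
  zero : ∀ᵐ ω ∂P, N 0 ω = 0
  monotone : ∀ᵐ ω ∂P, Monotone fun t => N t ω
  rightContinuous : ∀ᵐ ω ∂P, ∀ t : ℝ≥0, ContinuousWithinAt (fun s => N s ω) (Ici t) t
  law : ∀ s t : ℝ≥0, s ≤ t → HasLaw (fun ω => N t ω - N s ω) (poissonMeasure (r * (t - s))) P
  indep : ∀ s t : ℝ≥0, s ≤ t →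
    Indep (MeasurableSpace.comap (fun ω => N t ω - N s ω) inferInstance) (F s) P

/-- A simple predictable process `∑ i < n, coef i * 1_{(time i, time (i + 1)]}` with deterministic
times and bounded coefficients, `coef i` being `F (time i)`-measurable. -/
structure SimplePredictable (F : Filtration ℝ≥0 mΩ) where
  n : ℕ
  time : ℕ → ℝ≥0
  time_mono : Monotone time
  coef : ℕ → Ω → ℝ
  coef_meas : ∀ i, Measurable[F (time i)] (coef i)
  coef_bdd : ∃ C : ℝ, ∀ i ω, |coef i ω| ≤ C

/-- The value at time `s`. -/
def SimplePredictable.val {F : Filtration ℝ≥0 mΩ} (V : SimplePredictable F)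
    (s : ℝ≥0) (ω : Ω) : ℝ :=
  ∑ i ∈ Finset.range V.n, (Ioc (V.time i) (V.time (i + 1))).indicator (fun _ => V.coef i ω) s

/-- The elementary stochastic integral `∫₀ᵗ V dB`. -/
def SimplePredictable.integral {F : Filtration ℝ≥0 mΩ} (V : SimplePredictable F)
    (B : ℝ≥0 → Ω → ℝ) (t : ℝ≥0) (ω : Ω) : ℝ :=
  ∑ i ∈ Finset.range V.n,
    V.coef i ω * (B (min (V.time (i + 1)) t) ω - B (min (V.time i) t) ω)

/-- `I` is (a version of) the Itô integral `∫₀ᵗ H(s) dB(s)`: there are simple predictable `V k`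
such that `∫₀ᵗ |V k - H|² ds → 0` in probability and `∫₀ᵗ V k dB → I` in probability. -/
def IsItoIntegral (F : Filtration ℝ≥0 mΩ) (P : Measure Ω) (B : ℝ≥0 → Ω → ℝ)
    (H : ℝ≥0 → Ω → ℝ) (t : ℝ≥0) (I : Ω → ℝ) : Prop :=
  (∀ᵐ ω ∂P, AEMeasurable (fun s : ℝ => H s.toNNReal ω) (volume.restrict (Ioc 0 (t : ℝ)))) ∧
  ∃ V : ℕ → SimplePredictable F,
    (∀ ε : ℝ≥0∞, 0 < ε → Tendsto
      (fun k => P {ω | ε ≤ ∫⁻ s in Ioc 0 (t : ℝ),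
        ‖(V k).val s.toNNReal ω - H s.toNNReal ω‖ₑ ^ 2}) atTop (𝓝 0)) ∧
    TendstoInMeasure P (fun k => (V k).integral B t) atTop I

/-- The pathwise integral `∫_{(0,t]} H(s) dN(s) = ∑_{0 < s ≤ t} H(s) (N(s) - N(s-))` against a
counting path, a sum over the finitely many jump times in `(0, t]`. -/
def jumpIntegral (H : ℝ≥0 → ℝ) (N : ℝ≥0 → ℕ) (t : ℝ≥0) : ℝ :=
  ∑ᶠ s ∈ Ioc (0 : ℝ≥0) t, H s * ((N s : ℝ) - Function.leftLim (fun u => (N u : ℝ)) s)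

/-- `x` is càdlàg on `[a, b]`. -/
def IsCadlagOn (x : ℝ → ℝ) (a b : ℝ) : Prop :=
  (∀ t ∈ Ico a b, Tendsto x (𝓝[>] t) (𝓝 (x t))) ∧
  (∀ t ∈ Ioc a b, ∃ l : ℝ, Tendsto x (𝓝[<] t) (𝓝 l))

/-- `X`, restricted to the times `[-τ, T]`, solves
`X(t) = a + ∫₀ᵗ X(s - τ) dB(s) - ∫₀ᵗ X(s - τ) dN(s)` for `t ∈ [0, T]`, and `X(θ) = a` for
`θ ∈ [-τ, 0)`: it is adapted, has almost surely càdlàg paths, and for every `t ∈ [0, T]` the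
equation holds almost surely. -/
structure IsSolution (F : Filtration ℝ≥0 mΩ) (P : Measure Ω) (B : ℝ≥0 → Ω → ℝ)
    (N : ℝ≥0 → Ω → ℕ) (τ T a : ℝ) (X : ℝ → Ω → ℝ) : Prop where
  adapted : ∀ t : ℝ≥0, (t : ℝ) ≤ T → Measurable[F t] (X t)
  cadlag : ∀ᵐ ω ∂P, IsCadlagOn (fun t => X t ω) (-τ) T
  initial : ∀ᵐ ω ∂P, ∀ θ ∈ Ico (-τ) 0, X θ ω = a
  equation : ∀ t : ℝ≥0, (t : ℝ) ≤ T → ∃ I : Ω → ℝ,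
    IsItoIntegral F P B (fun s ω => X (s - τ) ω) t I ∧
    ∀ᵐ ω ∂P, X t ω = a + I ω - jumpIntegral (fun s => X (s - τ) ω) (fun s => N s ω) t

/-- The process equal to `c` at negative times and to `c (1 + B(t) - N(t))` at times `t ≥ 0`. -/
def explicitX (B : ℝ≥0 → Ω → ℝ) (N : ℝ≥0 → Ω → ℕ) (c : ℝ) (t : ℝ) (ω : Ω) : ℝ :=
  if t < 0 then c else c * (1 + B t.toNNReal ω - N t.toNNReal ω)

end DelayJump

end

/-! Up to time `min τ T` the integrands look back at the initial segment, where the solution is the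
constant `a`. So the Itô integral is `a * (B t - B 0)`, the jump integral is `a * (N t - N 0)`, and
the solution must be `a * (1 + B t - N t)`. With `a = c < 0` this is positive wherever `B t < -1`,
since `N ≥ 0`, and that event has positive Gaussian probability; with `a = 0` the solution is zero.
Order is lost at once.

The work lies in the two integrals. An Itô integral is known only as a limit in probability along
some approximating sequence, so its value for a constant integrand
(`IsItoIntegral.ae_eq_of_ae_eq_const`) needs Lenglart's inequality for step processes, obtained from
the isometry by truncation. The jump integral of a constant (`jumpIntegral_eq_of_eq_const`) requires
that a counting path be the sum of its jumps. Right-continuity then turns equality at each fixed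
time into equality of paths (`IsSolution.ae_eq_explicit`). -/

noncomputable section

namespace DelayJump

variable {Ω : Type*} {mΩ : MeasurableSpace Ω}

/-- The sum `∑ i < n, d i * (B (u (i + 1)) - B (u i))`. -/
def martingaleTransform (B : ℝ≥0 → Ω → ℝ) (u : ℕ → ℝ≥0) (d : ℕ → Ω → ℝ) (n : ℕ) (ω : Ω) : ℝ :=
  ∑ i ∈ Finset.range n, d i ω * (B (u (i + 1)) ω - B (u i) ω)

/-- The sum `∑ i < n, d i ^ 2 * (u (i + 1) - u i)`. -/
def stepEnergy (u : ℕ → ℝ≥0) (d : ℕ → Ω → ℝ) (n : ℕ) (ω : Ω) : ℝ :=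
  ∑ i ∈ Finset.range n, d i ω ^ 2 * ((u (i + 1) : ℝ) - u i)

/-! ### Itô isometry and Lenglart's inequality for step processes -/

section Brownian

variable {P : Measure Ω} {F : Filtration ℝ≥0 mΩ} {B : ℝ≥0 → Ω → ℝ}

lemma IsBrownianWrt.measurable_sub (hB : IsBrownianWrt F P B) (s t : ℝ≥0) :
    Measurable (fun ω => B t ω - B s ω) :=
  ((hB.adapted t).mono (F.le t) le_rfl).sub ((hB.adapted s).mono (F.le s) le_rfl)

lemma IsBrownianWrt.memLp_sub (hB : IsBrownianWrt F P B) (s t : ℝ≥0) :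
    MemLp (fun ω => B t ω - B s ω) 2 P :=
  (hB.isBrownian.isGaussianProcess.hasGaussianLaw_eval t).memLp_two.sub
    (hB.isBrownian.isGaussianProcess.hasGaussianLaw_eval s).memLp_two

lemma IsBrownianWrt.integral_sub (hB : IsBrownianWrt F P B) (s t : ℝ≥0) :
    ∫ ω, (B t ω - B s ω) ∂P = 0 := by
  rw [MeasureTheory.integral_sub (hB.isBrownian.integrable_eval t)
    (hB.isBrownian.integrable_eval s), hB.isBrownian.integral_eval, hB.isBrownian.integral_eval,
    sub_zero]

lemma IsBrownianWrt.integral_sub_sq (hB : IsBrownianWrt F P B) {s t : ℝ≥0} (hst : s ≤ t) :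
    ∫ ω, (B t ω - B s ω) ^ 2 ∂P = (t : ℝ) - s := by
  have h : Var[fun ω => B t ω - B s ω; P] = nndist (t : ℝ) (s : ℝ) :=
    (hB.isBrownian.hasLaw_sub t s).variance_eq.trans variance_id_gaussianReal
  rw [variance_of_integral_eq_zero (hB.measurable_sub s t).aemeasurable (hB.integral_sub s t)] at h
  have h0 : (s : ℝ) ≤ t := by exact_mod_cast hst
  simpa [Real.dist_eq, abs_of_nonneg (sub_nonneg.2 h0)] using h

lemma IsBrownianWrt.indepFun (hB : IsBrownianWrt F P B) {s t : ℝ≥0} (hst : s ≤ t) {f : Ω → ℝ}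
    (hf : Measurable[F s] f) : IndepFun (fun ω => B t ω - B s ω) f P := by
  rw [IndepFun_iff_Indep]
  exact indep_of_indep_of_le_right (hB.indep s t hst) hf.comap_le

variable {u : ℕ → ℝ≥0} {d : ℕ → Ω → ℝ}

lemma measurable_martingaleTransform (hB : Adapted F B) (hu : Monotone u)
    (hd : ∀ i, Measurable[F (u i)] (d i)) (n : ℕ) :
    Measurable[F (u n)] (martingaleTransform B u d n) := by
  unfold martingaleTransform
  refine Finset.measurable_sum _ fun i hi => ?_
  have hi : i + 1 ≤ n := Finset.mem_range.1 hi
  have h1 := (hd i).mono (F.mono (hu (i.le_succ.trans hi))) le_rfl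
  have h2 := (hB (u (i + 1))).mono (F.mono (hu hi)) le_rfl
  have h3 := (hB (u i)).mono (F.mono (hu (i.le_succ.trans hi))) le_rfl
  exact h1.mul (h2.sub h3)

lemma measurable_stepEnergy (hd : ∀ i, Measurable[F (u i)] (d i)) (n : ℕ)
    (s : ℝ≥0) (hs : ∀ i < n, u i ≤ s) : Measurable[F s] (stepEnergy u d n) := by
  unfold stepEnergy
  refine Finset.measurable_sum _ fun i hi => ?_
  have h1 := (hd i).mono (F.mono (hs i (Finset.mem_range.1 hi))) le_rfl
  exact (h1.pow_const 2).mul_const _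

variable [IsProbabilityMeasure P] {C : ℝ}

lemma IsBrownianWrt.memLp_mul_sub (hB : IsBrownianWrt F P B)
    (hd : ∀ i, Measurable[F (u i)] (d i)) (hC : ∀ i ω, |d i ω| ≤ C) (i : ℕ) :
    MemLp (fun ω => d i ω * (B (u (i + 1)) ω - B (u i) ω)) 2 P := by
  have h : MemLp (d i) ∞ P := MemLp.of_bound
    ((hd i).mono (F.le _) le_rfl).aestronglyMeasurable C (Eventually.of_forall (hC i))
  exact MemLp.mul (hB.memLp_sub (u i) (u (i + 1))) h

lemma IsBrownianWrt.memLp_martingaleTransform (hB : IsBrownianWrt F P B)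
    (hd : ∀ i, Measurable[F (u i)] (d i)) (hC : ∀ i ω, |d i ω| ≤ C) (n : ℕ) :
    MemLp (martingaleTransform B u d n) 2 P := by
  unfold martingaleTransform
  exact memLp_finsetSum _ fun i _ => hB.memLp_mul_sub hd hC i

lemma integrable_stepEnergy (hd : ∀ i, Measurable[F (u i)] (d i)) (hC : ∀ i ω, |d i ω| ≤ C)
    (n : ℕ) : Integrable (stepEnergy u d n) P := by
  unfold stepEnergy
  refine integrable_finsetSum _ fun i _ => Integrable.mul_const ?_ _
  exact (MemLp.of_bound ((hd i).mono (F.le _) le_rfl).aestronglyMeasurable C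
    (Eventually.of_forall (hC i)) : MemLp (d i) 2 P).integrable_sq

/-- The Itô isometry for step processes. -/
lemma IsBrownianWrt.integral_martingaleTransform_sq (hB : IsBrownianWrt F P B) (hu : Monotone u)
    (hd : ∀ i, Measurable[F (u i)] (d i)) (hC : ∀ i ω, |d i ω| ≤ C) (n : ℕ) :
    ∫ ω, martingaleTransform B u d n ω ^ 2 ∂P = ∫ ω, stepEnergy u d n ω ∂P := by
  induction n with
  | zero => simp [martingaleTransform, stepEnergy]
  | succ n ih =>
    set S := martingaleTransform B u d n with hS
    set D : Ω → ℝ := fun ω => B (u (n + 1)) ω - B (u n) ω with hD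
    have hu' : u n ≤ u (n + 1) := hu n.le_succ
    have hSm : Measurable[F (u n)] S := measurable_martingaleTransform hB.adapted hu hd n
    have hSL : MemLp S 2 P := hB.memLp_martingaleTransform hd hC n
    have hdL : MemLp (d n) 2 P := MemLp.of_bound
      ((hd n).mono (F.le _) le_rfl).aestronglyMeasurable C (Eventually.of_forall (hC n))
    have hDm : Measurable D := hB.measurable_sub _ _
    have hdD : MemLp (fun ω => d n ω * D ω) 2 P := hB.memLp_mul_sub hd hC n
    -- `S * d n` is known at time `u n`, hence independent of the centred increment `D`.
    have hcross : ∫ ω, S ω * (d n ω * D ω) ∂P = 0 := by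
      have hSd : Measurable[F (u n)] fun ω => S ω * d n ω := hSm.mul (hd n)
      have := (hB.indepFun hu' hSd).integral_fun_mul_eq_mul_integral hDm.aestronglyMeasurable
        (hSd.mono (F.le _) le_rfl).aestronglyMeasurable
      rw [hB.integral_sub, zero_mul] at this
      rw [← this]
      exact integral_congr_ae (Eventually.of_forall fun ω => by simp only [hD]; ring)
    have hsq : ∫ ω, (d n ω * D ω) ^ 2 ∂P = ∫ ω, d n ω ^ 2 * ((u (n + 1) : ℝ) - u n) ∂P := by
      have := ((hB.indepFun hu' (hd n)).comp (measurable_id.pow_const 2)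
        (measurable_id.pow_const 2)).integral_fun_mul_eq_mul_integral
        (hDm.pow_const 2).aestronglyMeasurable
        (((hd n).mono (F.le _) le_rfl).pow_const 2).aestronglyMeasurable
      simp only [Function.comp_apply, id] at this
      rw [hB.integral_sub_sq hu'] at this
      rw [integral_mul_const, mul_comm, ← this]
      exact integral_congr_ae (Eventually.of_forall fun ω => by simp only [hD]; ring)
    have e1 : ∀ ω, martingaleTransform B u d (n + 1) ω ^ 2
        = (S ω ^ 2 + 2 * (S ω * (d n ω * D ω))) + (d n ω * D ω) ^ 2 := fun ω => by
      simp only [martingaleTransform, Finset.sum_range_succ, hS, hD]; ring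
    have e2 : ∀ ω, stepEnergy u d (n + 1) ω
        = stepEnergy u d n ω + d n ω ^ 2 * ((u (n + 1) : ℝ) - u n) := fun ω => by
      simp only [stepEnergy, Finset.sum_range_succ]
    have hc : Integrable (fun ω => S ω * (d n ω * D ω)) P := hSL.integrable_mul hdD
    have hA : Integrable (fun ω => S ω ^ 2 + 2 * (S ω * (d n ω * D ω))) P :=
      hSL.integrable_sq.add (hc.const_mul 2)
    simp only [e1, e2]
    rw [integral_add hA hdD.integrable_sq,
      integral_add hSL.integrable_sq (hc.const_mul 2), integral_const_mul, hcross, hsq, ih,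
      integral_add (integrable_stepEnergy hd hC n) (hdL.integrable_sq.mul_const _)]
    ring

lemma stepEnergy_mono (hu : Monotone u) (ω : Ω) : Monotone fun n => stepEnergy u d n ω := by
  refine monotone_nat_of_le_succ fun n => ?_
  simp only [stepEnergy, Finset.sum_range_succ]
  have : (u n : ℝ) ≤ u (n + 1) := by exact_mod_cast hu n.le_succ
  nlinarith [sq_nonneg (d n ω)]

/-- The coefficients `d i`, set to `0` once the energy exceeds `ε`. -/
def truncate (u : ℕ → ℝ≥0) (d : ℕ → Ω → ℝ) (ε : ℝ) (i : ℕ) : Ω → ℝ :=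
  {ω | stepEnergy u d (i + 1) ω ≤ ε}.indicator (d i)

lemma truncate_of_le (hu : Monotone u) {ε : ℝ} {n i : ℕ} (hi : i < n) {ω : Ω}
    (h : stepEnergy u d n ω ≤ ε) : truncate u d ε i ω = d i ω :=
  indicator_of_mem (s := {ω | stepEnergy u d (i + 1) ω ≤ ε})
    ((stepEnergy_mono hu ω (Nat.succ_le_of_lt hi)).trans h) _

/-- The test for index `i` already counts the `i`-th term, so the energy never overshoots `ε`; this
costs nothing in adaptedness, since that term is known at time `u i`. -/
lemma stepEnergy_truncate_le (hu : Monotone u) {ε : ℝ} (hε : 0 ≤ ε) (n : ℕ) (ω : Ω) :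
    stepEnergy u (truncate u d ε) n ω ≤ ε := by
  induction n with
  | zero => simpa [stepEnergy] using hε
  | succ n ih =>
    by_cases h : stepEnergy u d (n + 1) ω ≤ ε
    · refine le_of_eq_of_le ?_ h
      exact Finset.sum_congr rfl fun i hi => by
        rw [truncate_of_le hu (Finset.mem_range.1 hi) h]
    · have : truncate u d ε n ω = 0 :=
        indicator_of_notMem (s := {ω | stepEnergy u d (n + 1) ω ≤ ε}) h _
      simpa [stepEnergy, Finset.sum_range_succ, this] using ih

/-- Lenglart's inequality for step processes. -/
lemma IsBrownianWrt.measure_le_martingaleTransform (hB : IsBrownianWrt F P B) (hu : Monotone u)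
    (hd : ∀ i, Measurable[F (u i)] (d i)) (hC : ∀ i ω, |d i ω| ≤ C) (n : ℕ) {ε δ : ℝ}
    (hε : 0 ≤ ε) (hδ : 0 < δ) :
    P {ω | δ ≤ |martingaleTransform B u d n ω|} ≤
      P {ω | ε ≤ stepEnergy u d n ω} + ENNReal.ofReal (ε / δ ^ 2) := by
  set d' := truncate u d ε
  have hd' : ∀ i, Measurable[F (u i)] (d' i) := fun i => by
    refine (hd i).indicator ?_
    exact measurable_stepEnergy hd (i + 1) (u i) (fun j hj => hu (Nat.le_of_lt_succ hj))
      measurableSet_Iic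
  have hC' : ∀ i ω, |d' i ω| ≤ C := fun i ω => by
    refine le_trans ?_ (hC i ω)
    by_cases h : stepEnergy u d (i + 1) ω ≤ ε <;> simp [d', truncate, indicator, h]
  set S := martingaleTransform B u d' n
  have hSL : MemLp S 2 P := hB.memLp_martingaleTransform hd' hC' n
  have hS : ∫ ω, S ω ^ 2 ∂P ≤ ε := by
    rw [hB.integral_martingaleTransform_sq hu hd' hC' n]
    refine (integral_mono (integrable_stepEnergy hd' hC' n) (integrable_const ε)
      fun ω => stepEnergy_truncate_le hu hε n ω).trans ?_
    simp
  -- Chebyshev's inequality for the truncated transform.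
  have hM : P {ω | δ ≤ |S ω|} ≤ ENNReal.ofReal (ε / δ ^ 2) := by
    have h := mul_meas_ge_le_integral_of_nonneg (μ := P)
      (Eventually.of_forall fun ω => sq_nonneg (S ω)) hSL.integrable_sq (δ ^ 2)
    have e : {ω | δ ^ 2 ≤ S ω ^ 2} = {ω | δ ≤ |S ω|} := by
      ext ω
      simp only [mem_ofPred_eq, ← sq_abs (S ω)]
      exact pow_le_pow_iff_left₀ hδ.le (abs_nonneg _) two_ne_zero
    rw [e] at h
    rw [← ofReal_measureReal]
    refine ENNReal.ofReal_le_ofReal ?_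
    rw [le_div_iff₀ (by positivity), mul_comm]
    exact h.trans hS
  -- Where the full energy stays below `ε`, truncation changes nothing.
  refine le_trans ?_ (add_le_add_right hM _)
  refine (measure_mono ?_).trans (measure_union_le _ _)
  intro ω hω
  by_cases h : ε ≤ stepEnergy u d n ω
  · exact Or.inl h
  · right
    have : S ω = martingaleTransform B u d n ω := Finset.sum_congr rfl fun i hi => by
      simp only [d', truncate_of_le hu (Finset.mem_range.1 hi) (not_le.1 h).le]
    simpa [this] using hω

end Brownian

end DelayJump

end

noncomputable section

namespace DelayJump

variable {Ω : Type*} {mΩ : MeasurableSpace Ω}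

/-! ### The Itô integral of a constant -/

section Ito

variable {P : Measure Ω} {F : Filtration ℝ≥0 mΩ} {B : ℝ≥0 → Ω → ℝ}

lemma sum_setLIntegral_Ioc {u : ℕ → ℝ≥0} (hu : Monotone u) (g : ℝ → ℝ≥0∞) (n : ℕ) :
    ∑ i ∈ Finset.range n, ∫⁻ s in Ioc (u i : ℝ) (u (i + 1)), g s
      = ∫⁻ s in Ioc (u 0 : ℝ) (u n), g s := by
  induction n with
  | zero => simp
  | succ n ih =>
    rw [Finset.sum_range_succ, ih, ← lintegral_union measurableSet_Ioc, Ioc_union_Ioc_eq_Ioc]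
    · exact_mod_cast hu n.zero_le
    · exact_mod_cast hu n.le_succ
    · exact Ioc_disjoint_Ioc_of_le le_rfl

namespace SimplePredictable

variable (V : SimplePredictable F)

lemma val_of_mem {i : ℕ} (hi : i < V.n) {s : ℝ≥0} (hs : s ∈ Ioc (V.time i) (V.time (i + 1)))
    (ω : Ω) : V.val s ω = V.coef i ω := by
  unfold val
  rw [Finset.sum_eq_single i]
  · exact indicator_of_mem hs _
  · refine fun j _ hj => indicator_of_notMem (fun h => ?_) _
    rcases lt_or_gt_of_ne hj with hj | hj
    · exact absurd (hs.1.trans_le h.2) (not_lt.2 (V.time_mono hj))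
    · exact absurd (h.1.trans_le hs.2) (not_lt.2 (V.time_mono hj))
  · intro h
    exact absurd (Finset.mem_range.2 hi) h

lemma val_of_le {s : ℝ≥0} (hs : s ≤ V.time 0) (ω : Ω) : V.val s ω = 0 :=
  Finset.sum_eq_zero fun _ _ => indicator_of_notMem
    (fun h => absurd h.1 (not_lt.2 (hs.trans (V.time_mono (Nat.zero_le _))))) _

lemma val_of_lt {s : ℝ≥0} (hs : V.time V.n < s) (ω : Ω) : V.val s ω = 0 :=
  Finset.sum_eq_zero fun _ hi => indicator_of_notMem
    (fun h => absurd (hs.trans_le h.2)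
      (not_lt.2 (V.time_mono (Nat.succ_le_of_lt (Finset.mem_range.1 hi))))) _

/-- The times of `V` below `t`, completed by `0` and `t`. -/
def cutTime (t : ℝ≥0) : ℕ → ℝ≥0
  | 0 => 0
  | i + 1 => if i ≤ V.n then min (V.time i) t else t

open Classical in
/-- The value of `V - a` on the interval between the `i`-th and the next time of `V.cutTime t`. -/
def cutCoef (t : ℝ≥0) (a : ℝ) : ℕ → Ω → ℝ
  | 0 => fun _ => -a
  | i + 1 => if i < V.n ∧ V.time i ≤ t then fun ω => V.coef i ω - a else fun _ => -a

variable (t : ℝ≥0) (a : ℝ)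

lemma cutTime_succ {i : ℕ} (hi : i ≤ V.n) : V.cutTime t (i + 1) = min (V.time i) t := by
  simp [cutTime, hi]

lemma cutTime_last : V.cutTime t (V.n + 2) = t := by
  simp [cutTime]

lemma cutTime_mono : Monotone (V.cutTime t) := by
  refine monotone_nat_of_le_succ fun i => ?_
  cases i with
  | zero => exact zero_le
  | succ i =>
    by_cases h : i + 1 ≤ V.n
    · rw [V.cutTime_succ t h, V.cutTime_succ t (i.le_succ.trans h)]
      exact min_le_min_right _ (V.time_mono i.le_succ)
    · have : V.cutTime t (i + 1 + 1) = t := by simp [cutTime, h]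
      rw [this]
      rw [cutTime]
      split_ifs
      exacts [min_le_right _ _, le_rfl]

/-- The clause `V.time i ≤ t` in `cutCoef` matters here: a coefficient revealed after `t` need not
be `F t`-measurable. It would only multiply a zero increment. -/
lemma measurable_cutCoef (i : ℕ) : Measurable[F (V.cutTime t i)] (V.cutCoef t a i) := by
  cases i with
  | zero => exact measurable_const
  | succ i =>
    rw [cutCoef]
    split_ifs with h
    · rw [V.cutTime_succ t h.1.le, min_eq_left h.2]
      exact (V.coef_meas i).sub_const a
    · exact measurable_const

lemma exists_abs_cutCoef_le : ∃ C : ℝ, ∀ i ω, |V.cutCoef t a i ω| ≤ C := by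
  obtain ⟨C, hC⟩ := V.coef_bdd
  refine ⟨|C| + |a|, fun i ω => ?_⟩
  cases i with
  | zero => simp [cutCoef]
  | succ i =>
    rw [cutCoef]
    split_ifs
    · exact (norm_sub_le (V.coef i ω) a).trans
        (add_le_add ((hC i ω).trans (le_abs_self C)) le_rfl)
    · simp

lemma martingaleTransform_cut (ω : Ω) :
    martingaleTransform B (V.cutTime t) (V.cutCoef t a) (V.n + 2) ω
      = V.integral B t ω - a * (B t ω - B 0 ω) := by
  have h1 : ∀ i ∈ Finset.range V.n,
      V.cutCoef t a (i + 1) ω * (B (V.cutTime t (i + 1 + 1)) ω - B (V.cutTime t (i + 1)) ω)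
        = V.coef i ω * (B (min (V.time (i + 1)) t) ω - B (min (V.time i) t) ω)
          - a * (B (min (V.time (i + 1)) t) ω - B (min (V.time i) t) ω) := fun i hi => by
    have hi := Finset.mem_range.1 hi
    rw [V.cutTime_succ t hi.le, V.cutTime_succ t (Nat.succ_le_of_lt hi)]
    by_cases h : V.time i ≤ t
    · simp only [cutCoef, hi, h, and_self, if_true]
      ring
    · have h' := (not_le.1 h).le
      rw [min_eq_right h', min_eq_right (h'.trans (V.time_mono i.le_succ))]
      ring
  unfold martingaleTransform integral
  rw [Finset.sum_range_succ, Finset.sum_range_succ', Finset.sum_congr rfl h1,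
    Finset.sum_sub_distrib, ← Finset.mul_sum,
    Finset.sum_range_sub (fun i => B (min (V.time i) t) ω), cutTime_last,
    V.cutTime_succ t le_rfl, V.cutTime_succ t (Nat.zero_le _)]
  simp only [cutCoef, cutTime, lt_irrefl, false_and, if_false]
  ring

lemma val_sub_eq_cutCoef {i : ℕ} (hi : i < V.n + 2) {s : ℝ≥0}
    (hs : s ∈ Ioc (V.cutTime t i) (V.cutTime t (i + 1))) (ω : Ω) :
    V.val s ω - a = V.cutCoef t a i ω := by
  cases i with
  | zero =>
    rw [V.cutTime_succ t (Nat.zero_le _)] at hs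
    simp [cutCoef, V.val_of_le (hs.2.trans (min_le_left _ _))]
  | succ i =>
    rw [V.cutTime_succ t (by omega)] at hs
    rcases Nat.lt_or_ge i V.n with h | h
    · rw [V.cutTime_succ t h] at hs
      have ht : V.time i < t := by
        by_contra h'
        rw [min_eq_right (not_lt.1 h')] at hs
        exact absurd (hs.1.trans_le hs.2) (not_lt.2 (min_le_right _ _))
      rw [min_eq_left ht.le] at hs
      simp [cutCoef, h, ht.le, V.val_of_mem h ⟨hs.1, hs.2.trans (min_le_left _ _)⟩]
    · obtain rfl : i = V.n := by omega
      rw [cutTime_last] at hs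
      have ht : V.time V.n < s := by
        rcases min_lt_iff.1 hs.1 with h' | h'
        exacts [h', absurd h' (not_lt.2 hs.2)]
      simp [cutCoef, V.val_of_lt ht]

/-- The cut times partition `(0, t]` into cells on which `V - a` is constant. -/
lemma ofReal_stepEnergy_cut (ω : Ω) :
    ENNReal.ofReal (stepEnergy (V.cutTime t) (V.cutCoef t a) (V.n + 2) ω)
      = ∫⁻ s in Ioc 0 (t : ℝ), ‖V.val s.toNNReal ω - a‖ₑ ^ 2 := by
  have h := sum_setLIntegral_Ioc (V.cutTime_mono t)
    (fun s => ‖V.val s.toNNReal ω - a‖ₑ ^ 2) (V.n + 2)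
  rw [cutTime_last] at h
  have h0 : ((V.cutTime t 0 : ℝ≥0) : ℝ) = 0 := rfl
  rw [h0] at h
  have hm : ∀ i, (V.cutTime t i : ℝ) ≤ V.cutTime t (i + 1) := fun i => by
    exact_mod_cast V.cutTime_mono t i.le_succ
  rw [← h, stepEnergy, ENNReal.ofReal_sum_of_nonneg
    (fun i _ => mul_nonneg (sq_nonneg _) (sub_nonneg.2 (hm i)))]
  refine Finset.sum_congr rfl fun i hi => ?_
  have h1 : ∀ s ∈ Ioc (V.cutTime t i : ℝ) (V.cutTime t (i + 1)),
      ‖V.val s.toNNReal ω - a‖ₑ ^ 2 = ENNReal.ofReal (V.cutCoef t a i ω ^ 2) := fun s hs => by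
    have hs0 : 0 ≤ s := (NNReal.coe_nonneg _).trans hs.1.le
    rw [V.val_sub_eq_cutCoef t a (Finset.mem_range.1 hi)
      ⟨Real.lt_toNNReal_iff_coe_lt.2 hs.1, Real.toNNReal_le_iff_le_coe.2 hs.2⟩,
      Real.enorm_eq_ofReal_abs, ← ENNReal.ofReal_pow (abs_nonneg _), sq_abs]
  rw [setLIntegral_congr_fun measurableSet_Ioc h1, setLIntegral_const, Real.volume_Ioc,
    ENNReal.ofReal_mul (sq_nonneg _)]

end SimplePredictable

variable [IsProbabilityMeasure P]

lemma IsBrownianWrt.measure_le_integral_sub (hB : IsBrownianWrt F P B) (V : SimplePredictable F)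
    (t : ℝ≥0) (a : ℝ) {ε δ : ℝ} (hε : 0 < ε) (hδ : 0 < δ) :
    P {ω | δ ≤ |V.integral B t ω - a * (B t ω - B 0 ω)|} ≤
      P {ω | ENNReal.ofReal ε ≤ ∫⁻ s in Ioc 0 (t : ℝ), ‖V.val s.toNNReal ω - a‖ₑ ^ 2}
        + ENNReal.ofReal (ε / δ ^ 2) := by
  obtain ⟨C, hC⟩ := V.exists_abs_cutCoef_le t a
  have h := hB.measure_le_martingaleTransform (V.cutTime_mono t) (V.measurable_cutCoef t a) hC
    (V.n + 2) hε.le hδ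
  simp only [V.martingaleTransform_cut] at h
  refine h.trans (add_le_add_left (measure_mono fun ω hω => ?_) _)
  simp only [mem_ofPred_eq, ← V.ofReal_stepEnergy_cut] at hω ⊢
  exact ENNReal.ofReal_le_ofReal hω

/-- The Itô integral of a constant `a` is `a * (B t - B 0)`. -/
theorem IsItoIntegral.ae_eq_of_ae_eq_const (hB : IsBrownianWrt F P B) {H : ℝ≥0 → Ω → ℝ}
    {t : ℝ≥0} {I : Ω → ℝ} (hI : IsItoIntegral F P B H t I) {a : ℝ}
    (hH : ∀ᵐ ω ∂P, ∀ᵐ s ∂(volume.restrict (Ioc 0 (t : ℝ))), H s.toNNReal ω = a) :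
    I =ᵐ[P] fun ω => a * (B t ω - B 0 ω) := by
  obtain ⟨-, V, hV, hVI⟩ := hI
  -- Limits in probability are almost surely unique, so it suffices that the same elementary
  -- integrals converge to `a * (B t - B 0)`.
  refine tendstoInMeasure_ae_unique hVI (tendstoInMeasure_iff_norm.2 fun δ hδ => ?_)
  have hV' : ∀ ε : ℝ≥0∞, 0 < ε → Tendsto (fun k => P {ω | ε ≤
      ∫⁻ s in Ioc 0 (t : ℝ), ‖(V k).val s.toNNReal ω - a‖ₑ ^ 2}) atTop (𝓝 0) := fun ε hε => by
    refine (hV ε hε).congr fun k => measure_congr ?_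
    filter_upwards [hH] with ω hω
    have : ∫⁻ s in Ioc 0 (t : ℝ), ‖(V k).val s.toNNReal ω - H s.toNNReal ω‖ₑ ^ 2
        = ∫⁻ s in Ioc 0 (t : ℝ), ‖(V k).val s.toNNReal ω - a‖ₑ ^ 2 :=
      lintegral_congr_ae (hω.mono fun s hs => by simp only [hs])
    exact congrArg (fun x => ε ≤ x) this
  refine ENNReal.tendsto_nhds_zero.2 fun η hη => ?_
  -- With energy level `q * δ ^ 2` and `q < η / 2`, each of the two terms of Lenglart's bound is
  -- eventually at most `η / 2`.
  obtain ⟨q, hq0, hq⟩ := ENNReal.lt_iff_exists_nnreal_btwn.1 (ENNReal.half_pos hη.ne')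
  have hq0' : 0 < (q : ℝ) := by exact_mod_cast hq0
  have hε : 0 < q * δ ^ 2 := by positivity
  filter_upwards [ENNReal.tendsto_nhds_zero.1 (hV' _ (ENNReal.ofReal_pos.2 hε)) (η / 2)
    (ENNReal.half_pos hη.ne')] with k hk
  refine (hB.measure_le_integral_sub (V k) t a hε hδ).trans ?_
  rw [mul_div_cancel_right₀ _ (by positivity : δ ^ 2 ≠ 0), ENNReal.ofReal_coe_nnreal]
  exact (add_le_add hk hq.le).trans (ENNReal.add_halves η).le

/-- The step process equal to `a` on `(0, t]`. -/
def SimplePredictable.const (F : Filtration ℝ≥0 mΩ) (t : ℝ≥0) (a : ℝ) : SimplePredictable F where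
  n := 1
  time i := if i = 0 then 0 else t
  time_mono := monotone_nat_of_le_succ fun i => by by_cases h : i = 0 <;> simp [h]
  coef _ _ := a
  coef_meas _ := measurable_const
  coef_bdd := ⟨|a|, fun _ _ => le_rfl⟩

lemma isItoIntegral_of_ae_eq_const {P : Measure Ω} {H : ℝ≥0 → Ω → ℝ} {t : ℝ≥0} {a : ℝ}
    (hH : ∀ᵐ ω ∂P, ∀ᵐ s ∂(volume.restrict (Ioc 0 (t : ℝ))), H s.toNNReal ω = a) :
    IsItoIntegral F P B H t fun ω => a * (B t ω - B 0 ω) := by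
  refine ⟨?_, fun _ => SimplePredictable.const F t a, fun ε hε => ?_, ?_⟩
  · filter_upwards [hH] with ω hω
    exact aemeasurable_const.congr (hω.mono fun s hs => hs.symm)
  · refine tendsto_const_nhds.congr fun _ => (measure_eq_zero_iff_ae_notMem.2 ?_).symm
    filter_upwards [hH] with ω hω
    have : ∫⁻ s in Ioc 0 (t : ℝ),
        ‖(SimplePredictable.const F t a).val s.toNNReal ω - H s.toNNReal ω‖ₑ ^ 2 = 0 := by
      refine (lintegral_congr_ae (g := fun _ => 0) ?_).trans lintegral_zero
      filter_upwards [hω, ae_restrict_mem measurableSet_Ioc] with s hs hs'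
      rw [hs, (SimplePredictable.const F t a).val_of_mem (i := 0) one_pos
        ⟨Real.toNNReal_pos.2 hs'.1, Real.toNNReal_le_iff_le_coe.2 hs'.2⟩]
      simp [SimplePredictable.const]
    simpa [this] using hε.ne'
  · refine tendstoInMeasure_iff_norm.2 fun δ hδ => tendsto_const_nhds.congr fun _ => ?_
    simp [SimplePredictable.integral, SimplePredictable.const, not_le.2 hδ]

end Ito

end DelayJump

end

noncomputable section

namespace DelayJump

/-! ### Counting paths as sums of their jumps -/

section CountingPath

variable {n : ℝ≥0 → ℕ}

lemma leftLim_eq_of_Ico {u s : ℝ≥0} (hus : u < s) {m : ℕ} (h : ∀ v ∈ Ico u s, n v = m) :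
    Function.leftLim (fun v => (n v : ℝ)) s = m := by
  have : (𝓝[<] s).NeBot := nhdsLT_neBot_of_exists_lt ⟨u, hus⟩
  refine leftLim_eq_of_tendsto (tendsto_const_nhds.congr' ?_)
  filter_upwards [Ico_mem_nhdsLT hus] with v hv
  rw [h v hv]

/-- The left limit exists by monotonicity, and convergence in the discrete space `ℕ` means being
eventually constant. -/
lemma exists_Ico_eq (hn : Monotone n) {s : ℝ≥0} (hs : 0 < s) :
    ∃ u < s, ∀ v ∈ Ico u s, n v = n u := by
  have h : ∀ᶠ v in 𝓝[<] s, n v = Function.leftLim n s := by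
    have := hn.tendsto_leftLim s
    rw [nhds_discrete, tendsto_pure] at this
    exact this
  obtain ⟨l, hl, hls⟩ := (mem_nhdsLT_iff_exists_Ioo_subset' hs).1 h
  obtain ⟨u, hlu, hus⟩ := exists_between (show l < s from hl)
  exact ⟨u, hus, fun v hv => (hls ⟨hlu.trans_le hv.1, hv.2⟩).trans (hls ⟨hlu, hus⟩).symm⟩

/-- Strong induction on the value `n t`: remove the last jump before or at `t` and apply the
hypothesis just before it, where the path is smaller. Finiteness is carried along because `finsum`
is additive only over finite supports. -/
lemma finite_support_jump_and_finsum_jump (hn : Monotone n)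
    (hr : ∀ t, ContinuousWithinAt n (Ici t) t) (k : ℕ) : ∀ t : ℝ≥0, n t = k →
      (Ioc 0 t ∩ Function.support
        fun s => (n s : ℝ) - Function.leftLim (fun u => (n u : ℝ)) s).Finite ∧
      ∑ᶠ s ∈ Ioc (0 : ℝ≥0) t, ((n s : ℝ) - Function.leftLim (fun u => (n u : ℝ)) s)
        = (n t : ℝ) - n 0 := by
  induction k using Nat.strong_induction_on with
  | _ k ih =>
    rintro t rfl
    set j : ℝ≥0 → ℝ := fun s => (n s : ℝ) - Function.leftLim (fun u => (n u : ℝ)) s with hj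
    have hzero : ∀ {u s : ℝ≥0}, u < s → n u = n s → j s = 0 := fun {u s} hus h => by
      simp only [hj]
      rw [leftLim_eq_of_Ico hus (m := n s)
        fun v hv => le_antisymm (hn hv.2.le) (h ▸ hn hv.1), sub_self]
    rcases (hn (zero_le : 0 ≤ t)).eq_or_lt with h0 | h0
    · have hz : ∀ s ∈ Ioc 0 t, j s = 0 := fun s hs =>
        hzero hs.1 (le_antisymm (hn zero_le) (h0 ▸ hn hs.2))
      refine ⟨?_, ?_⟩
      · convert finite_empty
        exact eq_empty_of_forall_notMem fun s hs => hs.2 (hz s hs.1)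
      · rw [finsum_mem_congr rfl hz, finsum_mem_zero, h0, sub_self]
    -- `s = sInf A` is the first time the level `n t` is reached; right-continuity shows that it is
    -- attained there.
    · set A : Set ℝ≥0 := {v | n t ≤ n v}
      have hAt : t ∈ A := le_refl (n t)
      have hglb : IsGLB A (sInf A) := isGLB_csInf ⟨t, hAt⟩ (OrderBot.bddBelow A)
      set s := sInf A
      have hst : s ≤ t := hglb.1 hAt
      have hns : n s = n t := by
        refine le_antisymm (hn hst) ?_
        have h1 : ∀ᶠ v in 𝓝[≥] s, n v = n s := by
          have := hr s
          rw [ContinuousWithinAt, nhds_discrete, tendsto_pure] at this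
          exact this
        obtain ⟨v, hv, hv'⟩ := ((hglb.frequently_mem ⟨t, hAt⟩).and_eventually h1).exists
        exact hv' ▸ hv
      have hs : 0 < s := by
        refine pos_of_ne_zero fun h => ?_
        rw [h] at hns
        exact h0.ne hns
      obtain ⟨u, hus, hu⟩ := exists_Ico_eq hn hs
      have hnu : n u < n t := not_le.1 fun h => absurd (hglb.1 h) (not_le.2 hus)
      obtain ⟨hf, hsum⟩ := ih (n u) hnu u rfl
      have hiff : ∀ x ∈ Function.support j, x ∈ Ioc u t ↔ x ∈ ({s} : Set ℝ≥0) := by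
        intro x hx
        refine ⟨fun h => ?_, fun h => ?_⟩
        · rcases lt_trichotomy x s with h' | h' | h'
          · exact absurd (hzero h.1 (hu x ⟨h.1.le, h'⟩).symm) hx
          · exact h'
          · exact absurd (hzero h' (le_antisymm (hn h'.le) (hns ▸ hn h.2))) hx
        · rw [mem_singleton_iff.1 h]
          exact ⟨hus, hst⟩
      have hf' : (Ioc u t ∩ Function.support j).Finite :=
        (finite_singleton s).subset fun x hx => (hiff x hx.2).1 hx.1
      have hU : Ioc 0 t = Ioc 0 u ∪ Ioc u t :=
        (Ioc_union_Ioc_eq_Ioc zero_le (hus.le.trans hst)).symm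
      refine ⟨?_, ?_⟩
      · rw [hU, union_inter_distrib_right]
        exact hf.union hf'
      · rw [hU, finsum_mem_union' (Ioc_disjoint_Ioc_of_le le_rfl) hf hf', hsum,
          finsum_mem_inter_support_eq' _ _ _ hiff, finsum_mem_singleton]
        simp only [hj]
        rw [leftLim_eq_of_Ico hus hu, hns]
        ring

/-- The integral of a constant against a counting path. -/
theorem jumpIntegral_eq_of_eq_const (hn : Monotone n) (hr : ∀ t, ContinuousWithinAt n (Ici t) t)
    {H : ℝ≥0 → ℝ} {a : ℝ} {t : ℝ≥0} (hH : ∀ s ∈ Ioc 0 t, H s = a) :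
    jumpIntegral H n t = a * ((n t : ℝ) - n 0) := by
  obtain ⟨-, hsum⟩ := finite_support_jump_and_finsum_jump hn hr (n t) t rfl
  rw [← hsum, jumpIntegral, mul_finsum_mem]
  exact finsum_mem_congr rfl fun s hs => by rw [hH s hs]

lemma exists_tendsto_nhdsLT (hn : Monotone n) {s : ℝ≥0} (hs : 0 < s) :
    ∃ l : ℝ, Tendsto (fun v => (n v : ℝ)) (𝓝[<] s) (𝓝 l) := by
  obtain ⟨u, hus, hu⟩ := exists_Ico_eq hn hs
  refine ⟨n u, tendsto_const_nhds.congr' ?_⟩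
  filter_upwards [Ico_mem_nhdsLT hus] with v hv
  rw [hu v hv]

end CountingPath

end DelayJump

end

/-! ### Solutions of the delay equation up to time `τ` -/

noncomputable section

namespace DelayJump

variable {Ω : Type*} {mΩ : MeasurableSpace Ω} {P : Measure Ω} {F : Filtration ℝ≥0 mΩ}
  {B : ℝ≥0 → Ω → ℝ} {N : ℝ≥0 → Ω → ℕ} {r : ℝ≥0} {X : ℝ → Ω → ℝ} {τ S a : ℝ}

/-- When `t = τ`, the point `s = τ` looks at `x 0`, which the initial condition does not cover; it
is Lebesgue-null. -/
lemma ae_restrict_delay_eq {x : ℝ → ℝ} (hx : ∀ θ ∈ Ico (-τ) 0, x θ = a) {t : ℝ≥0} (ht : t ≤ τ) :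
    ∀ᵐ s ∂(volume.restrict (Ioc 0 (t : ℝ))), x ((s.toNNReal : ℝ) - τ) = a := by
  filter_upwards [ae_restrict_mem measurableSet_Ioc,
    ae_restrict_of_ae (compl_mem_ae_iff.2 (measure_singleton τ))] with s hs hsτ
  have h : s < τ := lt_of_le_of_ne (hs.2.trans ht) hsτ
  rw [Real.coe_toNNReal s hs.1.le]
  exact hx _ ⟨by linarith [hs.1], by linarith⟩

/-- A jump may sit at `s = τ`, so here the value `x 0` has to be supplied. -/
lemma delay_eq {x : ℝ → ℝ} (hx : ∀ θ ∈ Ico (-τ) 0, x θ = a) (hx0 : x 0 = a) {t : ℝ≥0}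
    (ht : t ≤ τ) : ∀ s ∈ Ioc (0 : ℝ≥0) t, x ((s : ℝ) - τ) = a := fun s hs => by
  have h1 : (s : ℝ) ≤ t := by exact_mod_cast hs.2
  have h0 : (0 : ℝ) < s := by exact_mod_cast hs.1
  rcases (h1.trans ht).eq_or_lt with h | h
  · rw [h, sub_self, hx0]
  · exact hx _ ⟨by linarith, by linarith⟩

section Uniqueness

variable [IsProbabilityMeasure P]

/-- At `t = 0` both integrals vanish and the equation reads `X 0 = a`. -/
lemma IsSolution.ae_eq_initial (hX : IsSolution F P B N τ S a X) (hB : IsBrownianWrt F P B)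
    (hN : IsPoissonWrt F P r N) (hτ : 0 < τ) (hS : 0 < S) : ∀ᵐ ω ∂P, X 0 ω = a := by
  obtain ⟨I, hI, hXI⟩ := hX.equation 0 (by simpa using hS.le)
  have hI' := hI.ae_eq_of_ae_eq_const hB (a := a)
    (hX.initial.mono fun ω hω => ae_restrict_delay_eq hω (by simpa using hτ.le))
  filter_upwards [hXI, hI', hN.monotone, hN.rightContinuous] with ω h1 h2 h3 h4
  rw [NNReal.coe_zero, h2, jumpIntegral_eq_of_eq_const h3 h4 (a := a) (fun s hs => by simp at hs)]
    at h1
  simpa using h1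

lemma IsSolution.ae_eq_apply (hX : IsSolution F P B N τ S a X) (hB : IsBrownianWrt F P B)
    (hN : IsPoissonWrt F P r N) (hτ : 0 < τ) (hS : 0 < S) {t : ℝ≥0} (ht : (t : ℝ) ≤ min τ S) :
    ∀ᵐ ω ∂P, X t ω = a * (1 + B t ω - N t ω) := by
  have htτ := ht.trans (min_le_left _ _)
  obtain ⟨I, hI, hXI⟩ := hX.equation t (ht.trans (min_le_right _ _))
  have hI' := hI.ae_eq_of_ae_eq_const hB (a := a)
    (hX.initial.mono fun ω hω => ae_restrict_delay_eq hω htτ)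
  filter_upwards [hXI, hI', hN.monotone, hN.rightContinuous, hX.initial,
    hX.ae_eq_initial hB hN hτ hS, hN.zero, hB.isBrownian.eval_zero_ae_eq_zero]
    with ω h1 h2 h3 h4 h5 h6 h7 h8
  rw [h1, h2, jumpIntegral_eq_of_eq_const h3 h4 (delay_eq h5 h6 htτ), h7, h8]
  push_cast
  ring

end Uniqueness

section Paths

variable {b : ℝ≥0 → ℝ} {n : ℝ≥0 → ℕ}

lemma tendsto_toNNReal_nhdsGT (t : ℝ) :
    Tendsto Real.toNNReal (𝓝[>] t) (𝓝[≥] t.toNNReal) := by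
  refine tendsto_nhdsWithin_iff.2
    ⟨(continuous_real_toNNReal.tendsto t).mono_left nhdsWithin_le_nhds, ?_⟩
  filter_upwards [self_mem_nhdsWithin] with s hs
  exact Real.toNNReal_le_toNNReal (le_of_lt hs)

lemma tendsto_toNNReal_nhdsLT {t : ℝ} (ht : 0 < t) :
    Tendsto Real.toNNReal (𝓝[<] t) (𝓝[<] t.toNNReal) := by
  refine tendsto_nhdsWithin_iff.2
    ⟨(continuous_real_toNNReal.tendsto t).mono_left nhdsWithin_le_nhds, ?_⟩
  filter_upwards [self_mem_nhdsWithin] with s hs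
  exact (Real.toNNReal_lt_toNNReal_iff ht).2 hs

lemma tendsto_explicit_nhdsGT (hb : Continuous b) (hr : ∀ t, ContinuousWithinAt n (Ici t) t)
    (a t : ℝ) :
    Tendsto (fun s : ℝ => a * (1 + b s.toNNReal - n s.toNNReal)) (𝓝[>] t)
      (𝓝 (a * (1 + b t.toNNReal - n t.toNNReal))) := by
  have h := tendsto_toNNReal_nhdsGT t
  have h1 := (hb.tendsto t.toNNReal).comp (h.mono_right nhdsWithin_le_nhds)
  have h2 : Tendsto (fun s : ℝ => (n s.toNNReal : ℝ)) (𝓝[>] t) (𝓝 (n t.toNNReal)) :=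
    ((continuous_of_discreteTopology (f := fun k : ℕ => (k : ℝ))).tendsto _).comp
      ((hr t.toNNReal).tendsto.comp h)
  exact ((h1.const_add 1).sub h2).const_mul a

lemma exists_tendsto_explicit_nhdsLT (hb : Continuous b) (hn : Monotone n) (a : ℝ) {t : ℝ}
    (ht : 0 < t) :
    ∃ l, Tendsto (fun s : ℝ => a * (1 + b s.toNNReal - n s.toNNReal)) (𝓝[<] t) (𝓝 l) := by
  have h := tendsto_toNNReal_nhdsLT ht
  have h1 := (hb.tendsto t.toNNReal).comp (h.mono_right nhdsWithin_le_nhds)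
  obtain ⟨l, hl⟩ := exists_tendsto_nhdsLT hn (Real.toNNReal_pos.2 ht)
  exact ⟨_, ((h1.const_add 1).sub (hl.comp h)).const_mul a⟩

/-- Every right neighbourhood of `t < m` contains a rational below `m`, so the two right limits
agree. -/
lemma eqOn_of_eq_rat {x f : ℝ → ℝ} {m : ℝ}
    (hx : ∀ t ∈ Ico 0 m, Tendsto x (𝓝[>] t) (𝓝 (x t)))
    (hf : ∀ t ∈ Ico 0 m, Tendsto f (𝓝[>] t) (𝓝 (f t)))
    (hq : ∀ q : ℚ, (q : ℝ) ∈ Icc 0 m → x q = f q) : EqOn x f (Ico 0 m) := by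
  intro t ht
  refine tendsto_nhds_unique_of_frequently_eq (hx t ht) (hf t ht) (frequently_iff.2 fun {U} hU => ?_)
  obtain ⟨e, he, heU⟩ := mem_nhdsGT_iff_exists_Ioo_subset.1 hU
  obtain ⟨q, hq1, hq2⟩ := exists_rat_btwn (lt_min (show t < e from he) ht.2)
  exact ⟨q, heU ⟨hq1, hq2.trans_le (min_le_left _ _)⟩,
    hq q ⟨ht.1.trans hq1.le, hq2.le.trans (min_le_right _ _)⟩⟩

end Paths

theorem IsSolution.ae_eq_explicit [IsProbabilityMeasure P] (hX : IsSolution F P B N τ S a X)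
    (hB : IsBrownianWrt F P B) (hN : IsPoissonWrt F P r N) (hτ : 0 < τ) (hS : 0 < S) :
    ∀ᵐ ω ∂P, ∀ t : ℝ≥0, (t : ℝ) ≤ min τ S → X t ω = a * (1 + B t ω - N t ω) := by
  set m : ℝ≥0 := (min τ S).toNNReal with hm
  have hm' : (m : ℝ) = min τ S := Real.coe_toNNReal _ (lt_min hτ hS).le
  have hQ : ∀ᵐ ω ∂P, ∀ q : ℚ, (q : ℝ) ∈ Icc 0 (min τ S) →
      X q ω = a * (1 + B (q : ℝ).toNNReal ω - N (q : ℝ).toNNReal ω) := by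
    refine ae_all_iff.2 fun q => ?_
    by_cases hq : (q : ℝ) ∈ Icc 0 (min τ S)
    · have h0 := Real.coe_toNNReal _ hq.1
      filter_upwards [hX.ae_eq_apply hB hN hτ hS (t := (q : ℝ).toNNReal) (h0.trans_le hq.2)] with ω hω _
      rwa [h0] at hω
    · exact Eventually.of_forall fun ω h => absurd h hq
  filter_upwards [hQ, hX.ae_eq_apply hB hN hτ hS hm'.le, hX.cadlag, hB.isBrownian.cont,
    hN.rightContinuous] with ω h1 h2 h3 h4 h5 t ht
  rcases ht.eq_or_lt with h | h
  -- The right endpoint may be irrational and cannot be reached by right limits within the interval,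
  -- so it uses its own fixed-time identity.
  · obtain rfl : t = m := by rw [← NNReal.coe_inj, h, hm']
    exact h2
  · have := eqOn_of_eq_rat (x := fun s => X s ω) (m := min τ S)
      (f := fun s => a * (1 + B s.toNNReal ω - N s.toNNReal ω))
      (fun s hs => h3.1 s ⟨by linarith [hs.1], hs.2.trans_le (min_le_right _ _)⟩)
      (fun s _ => tendsto_explicit_nhdsGT h4 h5 a s) h1 ⟨t.coe_nonneg, h⟩
    simpa using this

lemma isCadlagOn_explicitX {ω : Ω} (hb : Continuous fun t => B t ω) (hn : Monotone fun t => N t ω)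
    (hr : ∀ t : ℝ≥0, ContinuousWithinAt (fun s => N s ω) (Ici t) t) (a τ S : ℝ) :
    IsCadlagOn (fun t => explicitX B N a t ω) (-τ) S := by
  have hneg : ∀ {t : ℝ}, t < 0 → explicitX B N a t ω = a := fun h => if_pos h
  have hpos : ∀ {t : ℝ}, 0 ≤ t →
      explicitX B N a t ω = a * (1 + B t.toNNReal ω - N t.toNNReal ω) := fun h => if_neg h.not_gt
  refine ⟨fun t _ => ?_, fun t _ => ?_⟩
  · rcases lt_or_ge t 0 with h | h
    · simp only [hneg h]
      refine tendsto_const_nhds.congr' ?_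
      filter_upwards [Ioo_mem_nhdsGT h] with s hs using (hneg hs.2).symm
    · simp only [hpos h]
      refine (tendsto_explicit_nhdsGT hb hr a t).congr' ?_
      filter_upwards [self_mem_nhdsWithin] with s hs
      exact (hpos (h.trans (le_of_lt hs))).symm
  · rcases le_or_gt t 0 with h | h
    · refine ⟨a, tendsto_const_nhds.congr' ?_⟩
      filter_upwards [self_mem_nhdsWithin] with s hs
      exact (hneg (lt_of_lt_of_le hs h)).symm
    · obtain ⟨l, hl⟩ := exists_tendsto_explicit_nhdsLT hb hn a h
      refine ⟨l, hl.congr' ?_⟩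
      filter_upwards [Ioo_mem_nhdsLT h] with s hs using (hpos hs.1.le).symm

/-- As `S ≤ τ`, the equation never looks past time `0`, where the process equals `a` almost surely.
-/
theorem isSolution_explicitX (hB : IsBrownianWrt F P B) (hN : IsPoissonWrt F P r N) (a : ℝ)
    (hS : S ≤ τ) : IsSolution F P B N τ S a (explicitX B N a) where
  adapted t _ := by
    have : explicitX B N a t = fun ω => a * (1 + B t ω - N t ω) := by
      funext ω
      simp [explicitX]
    rw [this]
    have hNt : Measurable[F t] fun ω => (N t ω : ℝ) :=
      (measurable_of_countable (fun k : ℕ => (k : ℝ))).comp (hN.adapted t)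
    exact (((hB.adapted t).const_add 1).sub hNt).const_mul a
  cadlag := by
    filter_upwards [hB.isBrownian.cont, hN.monotone, hN.rightContinuous] with ω h1 h2 h3
    exact isCadlagOn_explicitX h1 h2 h3 a τ S
  initial := Eventually.of_forall fun ω θ hθ => if_pos hθ.2
  equation t ht := by
    have hneg : ∀ ω, ∀ θ ∈ Ico (-τ) 0, explicitX B N a θ ω = a := fun ω θ hθ => if_pos hθ.2
    refine ⟨fun ω => a * (B t ω - B 0 ω), isItoIntegral_of_ae_eq_const
      (Eventually.of_forall fun ω => ae_restrict_delay_eq (x := fun s => explicitX B N a s ω)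
        (hneg ω) (ht.trans hS)), ?_⟩
    filter_upwards [hN.monotone, hN.rightContinuous, hN.zero,
      hB.isBrownian.eval_zero_ae_eq_zero] with ω h1 h2 h3 h4
    have h0 : explicitX B N a 0 ω = a := by simp [explicitX, h3, h4]
    rw [jumpIntegral_eq_of_eq_const h1 h2 (delay_eq (x := fun s => explicitX B N a s ω) (hneg ω) h0
      (ht.trans hS)), h3, h4]
    simp only [explicitX, not_lt.2 t.coe_nonneg, if_false, Real.toNNReal_coe]
    push_cast
    ring

/-- Lebesgue measure is absolutely continuous with respect to a nondegenerate Gaussian law. -/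
lemma IsBrownianWrt.measure_lt_pos (hB : IsBrownianWrt F P B) {t : ℝ≥0} (ht : 0 < t) (x : ℝ) :
    0 < P {ω | B t ω < x} := by
  have h : P {ω | B t ω < x} = gaussianReal 0 t (Iio x) := by
    rw [← (hB.isBrownian.hasLaw_eval t).map_eq,
      Measure.map_apply_of_aemeasurable (hB.isBrownian.aemeasurable t) measurableSet_Iio]
    rfl
  rw [h, pos_iff_ne_zero]
  intro h0
  simpa using gaussianReal_absolutelyContinuous' 0 ht.ne' h0

/-- Almost every section of a product-null set is null, and this direction needs no joint
measurability of `X`. -/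
lemma prod_pos_of_forall_section_pos [IsProbabilityMeasure P] {m : ℝ} (hm : 0 < m)
    (hX : ∀ t ∈ Ioc 0 m, 0 < P {ω | 0 < X t ω}) :
    0 < (volume.prod P) {p : ℝ × Ω | p.1 ∈ Icc 0 m ∧ 0 < X p.1 p.2} := by
  refine pos_iff_ne_zero.2 fun h => ?_
  have hsub : Ioc 0 m ⊆ {t | P (Prod.mk t ⁻¹' {p : ℝ × Ω | p.1 ∈ Icc 0 m ∧ 0 < X p.1 p.2}) = 0}ᶜ := by
    refine fun t ht h' => (hX t ht).ne' (measure_mono_null ?_ h')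
    exact fun ω hω => ⟨Ioc_subset_Icc_self ht, hω⟩
  have h1 : volume (Ioc 0 m) = 0 :=
    measure_mono_null hsub (mem_ae_iff.1 (Measure.measure_ae_null_of_prod_null h))
  simp [hm.not_ge] at h1

end DelayJump

end

theorem mainTheorem5 {Ω : Type*} {mΩ : MeasurableSpace Ω} (P : Measure Ω) [IsProbabilityMeasure P]
    (F : Filtration ℝ≥0 mΩ) (hF : DelayJump.UsualConditions F P)
    (B : ℝ≥0 → Ω → ℝ) (hB : DelayJump.IsBrownianWrt F P B)
    (r : ℝ≥0) (hr : 0 < r) (N : ℝ≥0 → Ω → ℕ) (hN : DelayJump.IsPoissonWrt F P r N)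
    (hBN : IndepFun (fun ω t => B t ω) (fun ω t => N t ω) P)
    (τ T c : ℝ) (hτ : 0 < τ) (hT : 0 < T) (hc : c < 0) :
    (∀ X Y : ℝ → Ω → ℝ,
      DelayJump.IsSolution F P B N τ T c X → DelayJump.IsSolution F P B N τ T 0 Y →
        (∀ᵐ ω ∂P, ∀ t : ℝ≥0, (t : ℝ) ≤ min τ T → X t ω = c * (1 + B t ω - N t ω)) ∧
        (∀ᵐ ω ∂P, ∀ t : ℝ≥0, (t : ℝ) ≤ min τ T → Y t ω = 0) ∧
        (∀ t : ℝ≥0, 0 < t → (t : ℝ) ≤ min τ T →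
          0 < P {ω | B t ω < -1} ∧ P {ω | B t ω < -1} ≤ P {ω | 0 < X t ω}) ∧
        0 < (volume.prod P) {p : ℝ × Ω | p.1 ∈ Icc 0 (min τ T) ∧ 0 < X p.1 p.2} ∧
        (∀ᵐ ω ∂P, ∀ θ ∈ Ico (-τ) 0, X θ ω ≤ Y θ ω) ∧
        (∀ᵐ ω ∂P, X 0 ω ≤ Y 0 ω) ∧
        ¬ ∀ᵐ ω ∂P, ∀ t ∈ Icc 0 T, X t ω ≤ Y t ω) ∧
    DelayJump.IsSolution F P B N τ (min τ T) c (DelayJump.explicitX B N c) ∧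
    DelayJump.IsSolution F P B N τ (min τ T) 0 (fun _ _ => 0) := by
  refine ⟨fun X Y hX hY => ?_, DelayJump.isSolution_explicitX hB hN c (min_le_left _ _), ?_⟩
  · have hXe := hX.ae_eq_explicit hB hN hτ hT
    have hYe : ∀ᵐ ω ∂P, ∀ t : ℝ≥0, (t : ℝ) ≤ min τ T → Y t ω = 0 := by
      simpa using hY.ae_eq_explicit hB hN hτ hT
    have hpos : ∀ t : ℝ≥0, 0 < t → (t : ℝ) ≤ min τ T →
        0 < P {ω | B t ω < -1} ∧ P {ω | B t ω < -1} ≤ P {ω | 0 < X t ω} := by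
      refine fun t ht htm => ⟨hB.measure_lt_pos ht _, measure_mono_ae ?_⟩
      filter_upwards [hXe] with ω hω (hBt : B t ω < -1)
      change 0 < X t ω
      rw [hω t htm]
      exact mul_pos_of_neg_of_neg hc (by linarith [(N t ω).cast_nonneg (α := ℝ)])
    have hm : 0 < min τ T := lt_min hτ hT
    have hpos' : ∀ t ∈ Ioc 0 (min τ T), 0 < P {ω | 0 < X t ω} := fun t ht => by
      have h := hpos t.toNNReal (Real.toNNReal_pos.2 ht.1)
        ((Real.coe_toNNReal t ht.1.le).trans_le ht.2)
      rw [Real.coe_toNNReal t ht.1.le] at h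
      exact h.1.trans_le h.2
    refine ⟨hXe, hYe, hpos, DelayJump.prod_pos_of_forall_section_pos hm hpos', ?_, ?_, fun h => ?_⟩
    · filter_upwards [hX.initial, hY.initial] with ω h1 h2 θ hθ
      rw [h1 θ hθ, h2 θ hθ]
      exact hc.le
    · filter_upwards [hX.ae_eq_initial hB hN hτ hT, hY.ae_eq_initial hB hN hτ hT] with ω h1 h2
      rw [h1, h2]
      exact hc.le
    -- Comparison at the single time `min τ T`, where `Y = 0`, would already make `{0 < X}` null.
    · refine (hpos' _ ⟨hm, le_rfl⟩).ne' (measure_eq_zero_iff_ae_notMem.2 ?_)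
      filter_upwards [h, hYe] with ω h1 h2
      have h3 := h2 (min τ T).toNNReal (Real.coe_toNNReal _ hm.le).le
      rw [Real.coe_toNNReal _ hm.le] at h3
      exact not_lt.2 ((h1 _ ⟨hm.le, min_le_right _ _⟩).trans_eq h3)
  · have h : DelayJump.explicitX B N 0 = fun _ _ => 0 := by
      funext t ω
      simp [DelayJump.explicitX]
    exact h ▸ DelayJump.isSolution_explicitX hB hN 0 (min_le_left _ _)
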